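/- **Conventions.** A (discrete-time LTI) system with $n_x$ states, $n_u$ inputs and $n_y$ outputs is a tuple $S=(A,B,C,D)$ of real matrices of sizes $n_x\times n_x$, $n_x\times n_u$, $n_y\times n_x$, $n_y\times n_u$, with $x_{k+1}=Ax_k+Bu_k$, $y_k=Cx_k+Du_k$. It is SISO if $n_u=n_y=1$. It is a minimal realization if no system with fewer states produces, from zero initial state, the same output sequence for every input sequence. The graph $G(S)$ has as vertices the state variables $x_i$, the inputs $u_j$ and the outputs $y_i$, with edges $(x_j,x_i)$ iff $A_{ij}\ne0$, $(u_j,x_i)$ iff $B_{ij}\ne0$, $(x_j,y_i)$ iff $C_{ij}\ne0$, $(u_j,y_i)$ iff $D_{ij}\ne0$, and no others. The condensed graph $CG(S)$ has as vertices the inputs, the outputs, and the strong components of $G(S)$ that consist of state variables (one-element components included). For components $c,c'$ (possibly equal), an input $u$ and an output $y$, it has the edge $(u,c)$ iff $G(S)$ has an edge from $u$ to a vertex of $c$; $(c,c')$ iff $G(S)$ has an edge from a vertex of $c$ to a vertex of $c'$ (so $c$ has a loop iff $G(S)$ has an edge inside $c$, including a loop); $(c,y)$ iff $G(S)$ has an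 edge from a vertex of $c$ to $y$; $(u,y)$ iff $(u,y)$ is an edge of $G(S)$; and no others. Two systems are CG-isomorphic if there is a directed-graph isomorphism between their condensed graphs that maps inputs to inputs, outputs to outputs and state components to state components. For a real $n\times n$ matrix $A$, let $D_k$ be the monic greatest common divisor of the minors of order $k$ of $\lambda I-A$ ($D_0=1$). The invariant polynomials of $A$ are $i_j=D_{n-j+1}/D_{n-j}$, $1\le j\le n$. The elementary divisors of $A$ are the powers $\phi^m$, $m>0$, of distinct monic real-irreducible polynomials $\phi$ that occur in the factorizations of $i_1,\dots,i_n$, listed with repetition. The companion matrix of $s^n+a_1s^{n-1}+\cdots+a_n$ is the $n\times n$ matrix with ones on the subdiagonal, last column $(-a_n,-a_{n-1},\dots,-a_1)^T$ and zeros elsewhere. $A$ is in second natural normal form if $A$ is block-diagonal with diagonal blocks $L_1,\dots,L_k$, where $L_i$ is the companion matrix of $e_i$ and $e_1,\dots,e_k$ are the elementary divisors of $A$ in some order. **Theorem.** Let $S_1=(A_1,B_1,C_1,D_1)$ and $S_2=(A_2,B_2,C_2,D_2)$ be two minimal SISO realizations where $A_1$ and $A_2$ are in second natural normal form and $0$ is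 not an eigenvalue of either $A_1$ or $A_2$. Then $S_1$ and $S_2$ are CG-isomorphic if and only if both of the following hold: 1. the number of distinct irreducible real polynomials (up to constant factors) that divide $\det(\lambda I-A_1)$ equals the number of those that divide $\det(\lambda I-A_2)$; 2. either $D_1=D_2=0$, or $D_1\ne0$ and $D_2\ne0$. -/

import Mathlib

/-- The associated (directed) graph of a square matrix `M`: there is an edge from `v` to `w`
exactly when the entry of `M` in row `w` and column `v` is nonzero. -/
def Matrix.associatedGraph {V : Type*} (M : Matrix V V ℝ) : Digraph V where
  Adj v w := M w v ≠ 0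

/-- The strong components of a directed graph: the equivalence classes of the relation
"there are directed paths (possibly of length zero) from `a` to `b` and from `b` to `a`". -/
def Digraph.strongComponents {V : Type*} (G : Digraph V) : Set (Set V) :=
  {c | ∃ a, c = {b | Relation.ReflTransGen G.Adj a b ∧ Relation.ReflTransGen G.Adj b a}}

/-- A discrete-time LTI state-space system with `nx` state variables, `nu` inputs and `ny` outputs:
`x (k+1) = A x k + B u k`, `y k = C x k + D u k`. -/
structure LTISystem (nx nu ny : ℕ) where
  A : Matrix (Fin nx) (Fin nx) ℝ
  B : Matrix (Fin nx) (Fin nu) ℝ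
  C : Matrix (Fin ny) (Fin nx) ℝ
  D : Matrix (Fin ny) (Fin nu) ℝ

namespace LTISystem

/-- The state sequence for the input sequence `u`, with zero initial state. -/
def stateSeq {nx nu ny : ℕ} (S : LTISystem nx nu ny) (u : ℕ → Fin nu → ℝ) : ℕ → Fin nx → ℝ
  | 0 => 0
  | k + 1 => S.A.mulVec (S.stateSeq u k) + S.B.mulVec (u k)

/-- The output sequence for the input sequence `u`, with zero initial state. -/
def outputSeq {nx nu ny : ℕ} (S : LTISystem nx nu ny) (u : ℕ → Fin nu → ℝ) (k : ℕ) : Fin ny → ℝ :=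
  S.C.mulVec (S.stateSeq u k) + S.D.mulVec (u k)

/-- Two systems are equivalent if, from zero initial conditions, they produce identical outputs for
every input sequence. -/
def Equivalent {nx nx' nu ny : ℕ} (S : LTISystem nx nu ny) (S' : LTISystem nx' nu ny) : Prop :=
  ∀ (u : ℕ → Fin nu → ℝ) (k : ℕ), S.outputSeq u k = S'.outputSeq u k

/-- A realization is minimal if no realization of the same input/output behaviour has fewer state
variables. -/
def IsMinimal {nx nu ny : ℕ} (S : LTISystem nx nu ny) : Prop :=
  ∀ (nx' : ℕ) (S' : LTISystem nx' nu ny), S.Equivalent S' → nx ≤ nx'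

/-- The vertices of the graph of a system: state variables, inputs and outputs, in this order. -/
abbrev Vertex (nx nu ny : ℕ) : Type := (Fin nx ⊕ Fin nu) ⊕ Fin ny

/-- The block matrix with block rows `[A B 0]`, `[0 0 0]`, `[C D 0]`. -/
def systemMatrix {nx nu ny : ℕ} (S : LTISystem nx nu ny) :
    Matrix (Vertex nx nu ny) (Vertex nx nu ny) ℝ :=
  Matrix.fromBlocks (Matrix.fromBlocks S.A S.B 0 0) 0 (Matrix.fromCols S.C S.D) 0

/-- The associated graph of a system. -/
def graph {nx nu ny : ℕ} (S : LTISystem nx nu ny) : Digraph (Vertex nx nu ny) :=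
  S.systemMatrix.associatedGraph

/-- The state variable components: the strong components consisting of state variable vertices. -/
def stateComponents {nx nu ny : ℕ} (S : LTISystem nx nu ny) : Set (Set (Vertex nx nu ny)) :=
  {c | c ∈ S.graph.strongComponents ∧ ∀ v ∈ c, ∃ i : Fin nx, v = Sum.inl (Sum.inl i)}

/-- The vertices of the condensed graph: the input vertices, the state variable components and the
output vertices. -/
inductive CondensedVertex {nx nu ny : ℕ} (S : LTISystem nx nu ny) : Type
  | input (i : Fin nu) : CondensedVertex S
  | component (c : S.stateComponents) : CondensedVertex S
  | output (i : Fin ny) : CondensedVertex S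

/-- The edges of the condensed graph. -/
def CondensedAdj {nx nu ny : ℕ} (S : LTISystem nx nu ny) :
    S.CondensedVertex → S.CondensedVertex → Prop
  | .input i, .component c => ∃ v ∈ c.1, S.graph.Adj (Sum.inl (Sum.inr i)) v
  | .component c, .component c' => ∃ v ∈ c.1, ∃ w ∈ c'.1, S.graph.Adj v w
  | .component c, .output j => ∃ v ∈ c.1, S.graph.Adj v (Sum.inr j)
  | .input i, .output j => S.graph.Adj (Sum.inl (Sum.inr i)) (Sum.inr j)
  | _, _ => False

/-- The condensed graph of a system. -/
def condensedGraph {nx nu ny : ℕ} (S : LTISystem nx nu ny) : Digraph S.CondensedVertex where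
  Adj := S.CondensedAdj

/-- Vertices of two condensed graphs are of the same type if both are inputs, both are outputs, or
both are state variable components. -/
def SameType {nx nu ny nx' nu' ny' : ℕ} {S : LTISystem nx nu ny} {S' : LTISystem nx' nu' ny'} :
    S.CondensedVertex → S'.CondensedVertex → Prop
  | .input _, .input _ => True
  | .component _, .component _ => True
  | .output _, .output _ => True
  | _, _ => False

/-- A CG-isomorphism: a type-restricted isomorphism between the condensed graphs. -/
structure IsCGIsomorphism {nx nu ny nx' nu' ny' : ℕ} (S : LTISystem nx nu ny)
    (S' : LTISystem nx' nu' ny') (φ : S.CondensedVertex → S'.CondensedVertex) : Prop where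
  typeRestricted : ∀ v, SameType v (φ v)
  bijective : Function.Bijective φ
  adj_iff : ∀ v w, S.condensedGraph.Adj v w ↔ S'.condensedGraph.Adj (φ v) (φ w)

/-- Two systems are CG-isomorphic if a CG-isomorphism between them exists. -/
def CGIsomorphic {nx nu ny nx' nu' ny' : ℕ} (S : LTISystem nx nu ny)
    (S' : LTISystem nx' nu' ny') : Prop :=
  ∃ φ : S.CondensedVertex → S'.CondensedVertex, IsCGIsomorphism S S' φ

end LTISystem

/-- The companion matrix of a (monic) polynomial `l` of degree `n`: ones on the subdiagonal, last
column `-l₀, -l₁, …, -lₙ₋₁` (coefficients of `1, s, …, sⁿ⁻¹`), all other entries zero. -/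
def companionMatrix (l : Polynomial ℝ) : Matrix (Fin l.natDegree) (Fin l.natDegree) ℝ :=
  Matrix.of fun i j =>
    if (j : ℕ) + 1 = l.natDegree then -l.coeff i
    else if (i : ℕ) = (j : ℕ) + 1 then 1
    else 0

noncomputable section

/-- The determinantal divisor `D_k`: the (monic) greatest common divisor of the minors of order `k`
of the characteristic matrix `λI - A`. -/
def Matrix.determinantalDivisor {n : ℕ} (A : Matrix (Fin n) (Fin n) ℝ) (k : ℕ) : Polynomial ℝ :=
  (Finset.univ : Finset ((Fin k ↪o Fin n) × (Fin k ↪o Fin n))).gcd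
    fun rc => ((Matrix.charmatrix A).submatrix rc.1 rc.2).det

/-- The invariant polynomials of `A`, `i_{j+1} = D_{n-j} / D_{n-j-1}` for `0 ≤ j < n`. -/
def Matrix.invariantPolynomial {n : ℕ} (A : Matrix (Fin n) (Fin n) ℝ) (j : Fin n) : Polynomial ℝ :=
  A.determinantalDivisor (n - j) / A.determinantalDivisor (n - j - 1)

open Classical in
/-- The elementary divisors of `A`, with multiplicity: the powers `φ ^ m`, `m > 0`, of distinct
monic irreducible polynomials `φ` in the factorizations of the invariant polynomials of `A`. -/
def Matrix.elementaryDivisors {n : ℕ} (A : Matrix (Fin n) (Fin n) ℝ) : Multiset (Polynomial ℝ) :=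
  ∑ j : Fin n,
    (UniqueFactorizationMonoid.normalizedFactors (A.invariantPolynomial j)).toFinset.val.map
      fun φ => φ ^ (UniqueFactorizationMonoid.normalizedFactors (A.invariantPolynomial j)).count φ

/-- `A` is in second natural normal form: for some ordering `e₁, …, eₖ` of the elementary divisors
of `A`, the matrix `A` is block-diagonal with the companion matrices of `e₁, …, eₖ` as its
consecutive diagonal blocks. -/
def Matrix.IsSecondNaturalNormalForm {n : ℕ} (A : Matrix (Fin n) (Fin n) ℝ) : Prop :=
  ∃ (k : ℕ) (e : Fin k → Polynomial ℝ) (h : ∑ i, (e i).natDegree = n),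
    (Finset.univ : Finset (Fin k)).val.map e = A.elementaryDivisors ∧
    A = Matrix.reindex (finSigmaFinEquiv.trans (finCongr h)) (finSigmaFinEquiv.trans (finCongr h))
      (Matrix.blockDiagonal' fun i => companionMatrix (e i))

/-- The number of distinct irreducible real polynomials (up to constant factors, so counted by their
monic representatives) that divide `det (λI - A)`. -/
def Matrix.numIrreducibleFactors {n : ℕ} (A : Matrix (Fin n) (Fin n) ℝ) : ℕ :=
  {p : Polynomial ℝ | p.Monic ∧ Irreducible p ∧ p ∣ A.charpoly}.ncard

end

/-! If a polynomial `p` annihilates the input-output response of a single-output system, then its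
Markov parameters satisfy the linear recurrence with characteristic polynomial `p`, so the observer
canonical form realizes the same behaviour with `deg p` states. Hence a minimal system whose state
matrix consists of companion blocks cannot lose the factor of any block: every block is acted on by
the inputs and read by the outputs, and its polynomial does not divide the product of the others.
For powers of irreducibles the latter forces the irreducibles to be distinct, so the blocks
correspond to the irreducible factors of the characteristic polynomial.

The graph of a companion matrix whose constant coefficient is nonzero is strongly connected, so the
blocks are the state components. The condensed graph thus consists of an input and an output joined
in parallel by looped components, and its only other possible edge is the one that `D` contributes.
-/

open Polynomial Matrix Relation

namespace LTISystem

section Realization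

variable {n n' nu ny : ℕ}

/-- The `k`-th Markov parameter, i.e. the response at time `k + 1` to a unit impulse at time `0`. -/
def markovParameter (S : LTISystem n nu ny) (k : ℕ) : Matrix (Fin ny) (Fin nu) ℝ :=
  S.C * S.A ^ k * S.B

theorem stateSeq_eq_sum (S : LTISystem n nu ny) (u : ℕ → Fin nu → ℝ) (k : ℕ) :
    S.stateSeq u k = ∑ j ∈ Finset.range k, (S.A ^ j * S.B) *ᵥ u (k - 1 - j) := by
  induction k with
  | zero => simp [stateSeq]
  | succ k ih =>
    simp only [stateSeq, ih, mulVec_sum, mulVec_mulVec, ← Matrix.mul_assoc, ← pow_succ',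
      Finset.sum_range_succ' _ k, pow_zero, Matrix.one_mul]
    simp [Nat.sub_add_eq, Nat.sub_right_comm]

theorem outputSeq_eq_sum (S : LTISystem n nu ny) (u : ℕ → Fin nu → ℝ) (k : ℕ) :
    S.outputSeq u k
      = ∑ j ∈ Finset.range k, S.markovParameter j *ᵥ u (k - 1 - j) + S.D *ᵥ u k := by
  simp only [outputSeq, stateSeq_eq_sum, mulVec_sum, mulVec_mulVec, markovParameter,
    Matrix.mul_assoc]

theorem Equivalent.of_markovParameter_eq {S : LTISystem n nu ny} {S' : LTISystem n' nu ny}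
    (h : ∀ k, S.markovParameter k = S'.markovParameter k) (hD : S.D = S'.D) : S.Equivalent S' :=
  fun u k => by simp only [outputSeq_eq_sum, h, hD]

end Realization

end LTISystem

section Companion

theorem charpoly_companionMatrix {l : ℝ[X]} (hl : l.Monic) : (companionMatrix l).charpoly = l := by
  have hmul := PowerBasis.leftMulMatrix (AdjoinRoot.powerBasis hl.ne_zero)
  have hchar := charpoly_leftMulMatrix (AdjoinRoot.powerBasis hl.ne_zero)
  rw [PowerBasis.minpolyGen_eq] at hmul
  rw [hmul, AdjoinRoot.minpoly_powerBasis_gen_of_monic hl] at hchar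
  exact hchar

theorem aeval_companionMatrix_eq_zero_of_dvd {l q : ℝ[X]} (hl : l.Monic) (h : l ∣ q) :
    aeval (companionMatrix l) q = 0 := by
  refine aeval_eq_zero_of_dvd_aeval_eq_zero h ?_
  simpa only [charpoly_companionMatrix hl] using aeval_self_charpoly (companionMatrix l)

theorem companionMatrix_transpose_mulVec {l : ℝ[X]} (hl : l.Monic) {s : ℕ → ℝ}
    (hs : ∑ j ∈ Finset.range (l.natDegree + 1), l.coeff j * s j = 0) (i : Fin l.natDegree) :
    ((companionMatrix l)ᵀ *ᵥ fun j => s j) i = s (i + 1) := by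
  simp only [mulVec, dotProduct, transpose_apply, companionMatrix, of_apply]
  by_cases hi : (i : ℕ) + 1 = l.natDegree
  · rw [Finset.sum_range_succ, hl.coeff_natDegree, one_mul, Finset.sum_range] at hs
    simp only [hi, if_true, neg_mul, Finset.sum_neg_distrib]
    exact (eq_neg_of_add_eq_zero_right hs).symm
  · rw [Finset.sum_eq_single ⟨i + 1, by omega⟩ (fun j _ hj => ?_) (by simp)]
    · simp [hi]
    · simp [hi, Fin.ext_iff.not.1 hj]

theorem reflTransGen_associatedGraph_companionMatrix_of_le {l : ℝ[X]} {a b : Fin l.natDegree}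
    (hab : a ≤ b) : ReflTransGen (companionMatrix l).associatedGraph.Adj a b := by
  refine reflTransGen_of_succ_of_le _ (fun i hi => ?_) hab
  have hsucc : (i : ℕ) + 1 = Order.succ i := Nat.covBy_iff_add_one_eq.1
    (Fin.covBy_iff.1 (Order.covBy_succ_of_not_isMax (not_isMax_of_lt hi.2)))
  have hlast : (i : ℕ) + 1 ≠ l.natDegree := hsucc ▸ (Order.succ i).isLt.ne
  simp [Matrix.associatedGraph, companionMatrix, hlast, ← hsucc]

theorem transGen_associatedGraph_companionMatrix {l : ℝ[X]} (h0 : l.coeff 0 ≠ 0)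
    (a b : Fin l.natDegree) : TransGen (companionMatrix l).associatedGraph.Adj a b := by
  have hpos : 0 < l.natDegree := a.pos
  let first : Fin l.natDegree := ⟨0, hpos⟩
  let last : Fin l.natDegree := ⟨l.natDegree - 1, Nat.sub_lt hpos one_pos⟩
  have to_last : ReflTransGen (companionMatrix l).associatedGraph.Adj a last :=
    reflTransGen_associatedGraph_companionMatrix_of_le (Nat.le_sub_one_of_lt a.isLt)
  have hlast : (last : ℕ) + 1 = l.natDegree := Nat.sub_add_cancel hpos
  have last_first : (companionMatrix l).associatedGraph.Adj last first := by
    simp [Matrix.associatedGraph, companionMatrix, first, hlast, h0]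
  exact (TransGen.tail' to_last last_first).trans_left
    (reflTransGen_associatedGraph_companionMatrix_of_le (Nat.zero_le b))

end Companion

namespace LTISystem

section ObserverForm

variable {n nu : ℕ} {p : ℝ[X]} {h : ℕ → Fin nu → ℝ} {D : Matrix (Fin 1) (Fin nu) ℝ}

/-- The single-output system in observer canonical form with characteristic polynomial `p`, whose
Markov parameters are `h` if `h` satisfies the linear recurrence with characteristic polynomial `p`.
Its state at time `k` predicts the next `p.natDegree` outputs under zero input. -/
def observerForm (p : ℝ[X]) (h : ℕ → Fin nu → ℝ) (D : Matrix (Fin 1) (Fin nu) ℝ) :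
    LTISystem p.natDegree nu 1 where
  A := (companionMatrix p)ᵀ
  B := Matrix.of fun i => h i
  C := Matrix.of fun _ i => if (i : ℕ) = 0 then 1 else 0
  D := D

theorem observerForm_A_pow_mul_B (hp : p.Monic)
    (hrec : ∀ m, ∑ j ∈ Finset.range (p.natDegree + 1), p.coeff j • h (m + j) = 0)
    (k : ℕ) (i : Fin p.natDegree) (u : Fin nu) :
    ((observerForm p h D).A ^ k * (observerForm p h D).B) i u = h (k + i) u := by
  induction k generalizing i with
  | zero => simp [observerForm]
  | succ k ih =>
    have hrec_u : ∑ j ∈ Finset.range (p.natDegree + 1), p.coeff j * h (k + j) u = 0 := by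
      simpa using congrFun (hrec k) u
    have hshift := companionMatrix_transpose_mulVec hp (s := fun j => h (k + j) u) hrec_u i
    rw [pow_succ', Matrix.mul_assoc, Matrix.mul_apply, add_right_comm, add_assoc, ← hshift]
    simp only [ih]
    rfl

theorem markovParameter_observerForm (hp : p.Monic)
    (hrec : ∀ m, ∑ j ∈ Finset.range (p.natDegree + 1), p.coeff j • h (m + j) = 0) (k : ℕ) :
    (observerForm p h D).markovParameter k = Matrix.of fun _ => h k := by
  ext y u
  have hC (i : Fin p.natDegree) :
      (observerForm p h D).C y i = if (i : ℕ) = 0 then 1 else 0 := rfl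
  rw [markovParameter, Matrix.mul_assoc, Matrix.mul_apply]
  simp only [observerForm_A_pow_mul_B hp hrec, hC, ite_mul, one_mul, zero_mul, of_apply]
  by_cases hd : p.natDegree = 0
  · have : IsEmpty (Fin p.natDegree) := hd ▸ Fin.isEmpty
    simpa [hp.natDegree_eq_zero.1 hd] using (congrFun (hrec k) u).symm
  · rw [Finset.sum_eq_single ⟨0, Nat.pos_of_ne_zero hd⟩ (fun i _ hi => ?_) (by simp)]
    · simp
    · simp [Fin.ext_iff.not.1 hi]

theorem IsMinimal.le_natDegree {S : LTISystem n nu 1} (hS : S.IsMinimal) (hp : p.Monic)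
    (hann : ∀ q, p ∣ q → S.C * aeval S.A q * S.B = 0) : n ≤ p.natDegree := by
  refine hS _ (observerForm p (fun k => S.markovParameter k 0) S.D)
    (.of_markovParameter_eq (fun k => ?_) rfl)
  rw [markovParameter_observerForm hp fun m => ?_]
  · ext y
    rw [Subsingleton.elim y 0, of_apply]
  · have hsum := hann (X ^ m * p) (dvd_mul_left _ _)
    rw [map_mul, map_pow, aeval_X, aeval_eq_sum_range] at hsum
    ext u
    simpa [Matrix.mul_sum, Matrix.sum_mul, markovParameter, pow_add, Finset.mul_sum,
      Matrix.mul_assoc, Matrix.sum_apply] using congrFun (congrFun hsum 0) u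

end ObserverForm

end LTISystem

section BlockDiagonal

variable {ι R : Type*} [Fintype ι] [DecidableEq ι] {m : ι → Type*} [∀ i, Fintype (m i)]

theorem mul_reindex_blockDiagonal'_mul [NonUnitalSemiring R] {n r c : Type*} [Fintype n]
    (σ : (Σ i, m i) ≃ n) (L : Matrix r n R) (M : ∀ i, Matrix (m i) (m i) R) (N : Matrix n c R) :
    L * reindex σ σ (blockDiagonal' M) * N =
      ∑ i, L.submatrix id (fun a => σ ⟨i, a⟩) * M i * N.submatrix (fun a => σ ⟨i, a⟩) id := by
  ext x y
  simp only [Matrix.mul_apply, Matrix.sum_apply, ← σ.sum_comp, reindex_apply, submatrix_apply,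
    Equiv.symm_apply_apply, Fintype.sum_sigma, id_eq]
  refine Finset.sum_congr rfl fun j _ => Finset.sum_congr rfl fun b _ => ?_
  rw [Finset.sum_eq_single j (fun i _ hij => ?_) (by simp)]
  · simp only [blockDiagonal'_apply_eq]
  · simp only [blockDiagonal'_apply_ne M _ _ hij, mul_zero, Finset.sum_const_zero]

variable [∀ i, DecidableEq (m i)]

theorem det_blockDiagonal' [CommRing R] (M : ∀ i, Matrix (m i) (m i) R) :
    (blockDiagonal' M).det = ∏ i, (M i).det := by
  let e := Fintype.equivFin ι
  have htri : BlockTriangular (blockDiagonal' M) fun x => e x.1 := fun _ _ hlt =>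
    blockDiagonal'_apply_ne M _ _ fun heq => hlt.ne (congrArg e heq.symm)
  rw [htri.det_fintype, ← e.prod_comp]
  refine Finset.prod_congr rfl fun i _ => ?_
  rw [← det_reindex_self ((Equiv.subtypeEquivRight fun _ => e.apply_eq_iff_eq).trans
    (Equiv.sigmaSubtype i))]
  congr 1
  ext a b
  simp [toSquareBlock_def, Equiv.sigmaSubtype]

theorem charpoly_blockDiagonal' [CommRing R] (M : ∀ i, Matrix (m i) (m i) R) :
    (blockDiagonal' M).charpoly = ∏ i, (M i).charpoly := by
  have hcharmatrix :
      (blockDiagonal' M).charmatrix = blockDiagonal' fun i => (M i).charmatrix := by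
    simp only [charmatrix]
    ext ⟨i, a⟩ ⟨j, b⟩ : 2
    by_cases hij : i = j
    · subst hij
      by_cases hab : a = b <;> simp [hab]
    · simp [hij, blockDiagonal'_apply_ne]
  rw [Matrix.charpoly, hcharmatrix, det_blockDiagonal']
  rfl

theorem aeval_blockDiagonal' [CommRing R] (M : ∀ i, Matrix (m i) (m i) R) (q : R[X]) :
    aeval (blockDiagonal' M) q = blockDiagonal' fun i => aeval (M i) q := by
  let blockDiagonalAlgHom : (∀ i, Matrix (m i) (m i) R) →ₐ[R] Matrix (Σ i, m i) (Σ i, m i) R :=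
    AlgHom.ofLinearMap
      { blockDiagonal'AddMonoidHom m m R with map_smul' := blockDiagonal'_smul }
      blockDiagonal'_one blockDiagonal'_mul
  rw [← aeval_pi_apply M q]
  exact aeval_algHom_apply blockDiagonalAlgHom M q

theorem mul_aeval_reindex_blockDiagonal'_mul [CommRing R] {n r c : Type*} [Fintype n]
    [DecidableEq n] (σ : (Σ i, m i) ≃ n) (L : Matrix r n R) (M : ∀ i, Matrix (m i) (m i) R)
    (N : Matrix n c R) (q : R[X]) :
    L * aeval (reindex σ σ (blockDiagonal' M)) q * N =
      ∑ i, L.submatrix id (fun a => σ ⟨i, a⟩) * aeval (M i) q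
        * N.submatrix (fun a => σ ⟨i, a⟩) id := by
  have hreindex : aeval (reindex σ σ (blockDiagonal' M)) q
      = reindex σ σ (blockDiagonal' fun i => aeval (M i) q) := by
    rw [← aeval_blockDiagonal']
    exact aeval_algHom_apply (reindexAlgEquiv R R σ) (blockDiagonal' M) q
  rw [hreindex, mul_reindex_blockDiagonal'_mul]

end BlockDiagonal

section PrimePowers

variable {ι : Type*}

theorem injective_of_not_pow_dvd_prod_erase [Fintype ι] [DecidableEq ι] {M : Type*} [CommMonoid M]
    {φ : ι → M} {m : ι → ℕ} (h : ∀ i, ¬ φ i ^ m i ∣ ∏ l ∈ Finset.univ.erase i, φ l ^ m l) :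
    Function.Injective φ := by
  intro i j hij
  by_contra hne
  wlog hle : m i ≤ m j generalizing i j
  · exact this hij.symm (Ne.symm hne) (le_of_not_ge hle)
  refine h i (dvd_trans ?_ (Finset.dvd_prod_of_mem (fun l => φ l ^ m l)
    (Finset.mem_erase.2 ⟨Ne.symm hne, Finset.mem_univ j⟩)))
  rw [hij]
  exact pow_dvd_pow _ hle

variable {K : Type*} [Field K]

theorem exists_monic_irreducible_pow_eq {e : K[X]} (he : e.Monic) (hpow : IsPrimePow e) :
    ∃ (φ : K[X]) (m : ℕ), φ.Monic ∧ Irreducible φ ∧ 0 < m ∧ φ ^ m = e := by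
  classical
  obtain ⟨φ, m, hφ, hm, rfl⟩ := hpow
  refine ⟨normalize φ, m, monic_normalize hφ.ne_zero,
    (normalize_associated φ).symm.irreducible hφ.irreducible, hm, ?_⟩
  exact eq_of_monic_of_associated ((monic_normalize hφ.ne_zero).pow m) he
    (normalize_associated φ).pow_pow

theorem setOf_monic_irreducible_dvd_prod_pow [Fintype ι] {φ : ι → K[X]} {m : ι → ℕ}
    (hmonic : ∀ i, (φ i).Monic) (hirr : ∀ i, Irreducible (φ i)) (hm : ∀ i, 0 < m i) :
    {p : K[X] | p.Monic ∧ Irreducible p ∧ p ∣ ∏ i, φ i ^ m i} = Set.range φ := by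
  ext p
  constructor
  · rintro ⟨hp, hpirr, hdvd⟩
    obtain ⟨i, -, hi⟩ := (hpirr.prime.dvd_finsetProd_iff _).1 hdvd
    exact ⟨i, (eq_of_monic_of_associated hp (hmonic i)
      (hpirr.associated_of_dvd (hirr i) (hpirr.prime.dvd_of_dvd_pow hi))).symm⟩
  · rintro ⟨i, rfl⟩
    exact ⟨hmonic i, hirr i, (dvd_pow_self _ (hm i).ne').trans
      (Finset.dvd_prod_of_mem (fun l => φ l ^ m l) (Finset.mem_univ i))⟩

theorem ncard_monic_irreducible_dvd_prod [Fintype ι] [DecidableEq ι] {e : ι → K[X]}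
    (hmonic : ∀ i, (e i).Monic) (hpow : ∀ i, IsPrimePow (e i))
    (h : ∀ i, ¬ e i ∣ ∏ l ∈ Finset.univ.erase i, e l) :
    {p : K[X] | p.Monic ∧ Irreducible p ∧ p ∣ ∏ i, e i}.ncard = Nat.card ι := by
  choose φ m hφ hirr hm he using fun i => exists_monic_irreducible_pow_eq (hmonic i) (hpow i)
  obtain rfl : (fun i => φ i ^ m i) = e := funext he
  rw [setOf_monic_irreducible_dvd_prod_pow hφ hirr hm,
    Set.ncard_range_of_injective (injective_of_not_pow_dvd_prod_erase h)]

end PrimePowers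

theorem monic_and_isPrimePow_of_mem_elementaryDivisors {n : ℕ} {A : Matrix (Fin n) (Fin n) ℝ}
    {e : ℝ[X]} (he : e ∈ A.elementaryDivisors) : e.Monic ∧ IsPrimePow e := by
  classical
  simp only [Matrix.elementaryDivisors, Multiset.mem_sum, Multiset.mem_map, Finset.mem_val,
    Multiset.mem_toFinset] at he
  obtain ⟨j, -, φ, hφ, rfl⟩ := he
  have hirr := UniqueFactorizationMonoid.irreducible_of_normalized_factor φ hφ
  have hmonic : φ.Monic := by
    rw [← UniqueFactorizationMonoid.normalize_normalized_factor φ hφ]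
    exact monic_normalize hirr.ne_zero
  exact ⟨hmonic.pow _, hirr.prime.isPrimePow.pow (Multiset.count_ne_zero.2 hφ)⟩

/-- A presentation of `A`, up to the reordering `indexEquiv` of its indices, as a block-diagonal
matrix whose blocks are the companion matrices of the nonconstant monic polynomials `poly i`. It
captures natural normal forms, whichever divisors of the characteristic polynomial they use. -/
structure CompanionBlocks {n : ℕ} (A : Matrix (Fin n) (Fin n) ℝ) (ι : Type*) [DecidableEq ι] where
  poly : ι → ℝ[X]
  monic : ∀ i, (poly i).Monic
  natDegree_pos : ∀ i, 0 < (poly i).natDegree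
  indexEquiv : (Σ i, Fin (poly i).natDegree) ≃ Fin n
  eq_reindex : A = reindex indexEquiv indexEquiv (blockDiagonal' fun i => companionMatrix (poly i))

theorem exists_companionBlocks_of_isSecondNaturalNormalForm {n : ℕ} {A : Matrix (Fin n) (Fin n) ℝ}
    (hA : A.IsSecondNaturalNormalForm) :
    ∃ (k : ℕ) (P : CompanionBlocks A (Fin k)), ∀ i, IsPrimePow (P.poly i) := by
  obtain ⟨k, e, h, he, hA⟩ := hA
  have hmem (i) : e i ∈ A.elementaryDivisors := he ▸ Multiset.mem_map_of_mem e (Finset.mem_univ i)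
  have hmonic (i) := (monic_and_isPrimePow_of_mem_elementaryDivisors (hmem i)).1
  have hpow (i) := (monic_and_isPrimePow_of_mem_elementaryDivisors (hmem i)).2
  have hdeg (i) : 0 < (e i).natDegree :=
    Nat.pos_of_ne_zero fun hdeg => (hpow i).ne_one ((hmonic i).natDegree_eq_zero.1 hdeg)
  exact ⟨k, ⟨e, hmonic, hdeg, _, hA⟩, hpow⟩

namespace CompanionBlocks

variable {n nu ny : ℕ} {A : Matrix (Fin n) (Fin n) ℝ} {ι : Type*} [DecidableEq ι]
  (P : CompanionBlocks A ι)

/-- The rows of an input matrix `B` that act on the `i`-th block of states. -/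
def inputBlock (B : Matrix (Fin n) (Fin nu) ℝ) (i : ι) :
    Matrix (Fin (P.poly i).natDegree) (Fin nu) ℝ :=
  B.submatrix (fun a => P.indexEquiv ⟨i, a⟩) id

/-- The columns of an output matrix `C` that read the `i`-th block of states. -/
def outputBlock (C : Matrix (Fin ny) (Fin n) ℝ) (i : ι) :
    Matrix (Fin ny) (Fin (P.poly i).natDegree) ℝ :=
  C.submatrix id fun a => P.indexEquiv ⟨i, a⟩

protected theorem finite (P : CompanionBlocks A ι) : Finite ι :=
  Finite.of_surjective (fun v => (P.indexEquiv.symm v).1) fun i =>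
    ⟨P.indexEquiv ⟨i, 0, P.natDegree_pos i⟩, by simp only [Equiv.symm_apply_apply]⟩

theorem mul_aeval_mul [Fintype ι] (C : Matrix (Fin ny) (Fin n) ℝ) (B : Matrix (Fin n) (Fin nu) ℝ)
    (q : ℝ[X]) :
    C * aeval A q * B =
      ∑ i, P.outputBlock C i * aeval (companionMatrix (P.poly i)) q * P.inputBlock B i := by
  conv_lhs => rw [P.eq_reindex]
  exact mul_aeval_reindex_blockDiagonal'_mul _ _ _ _ _

theorem charpoly_eq_prod [Fintype ι] : A.charpoly = ∏ i, P.poly i := by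
  conv_lhs => rw [P.eq_reindex]
  simp only [charpoly_reindex, charpoly_blockDiagonal', charpoly_companionMatrix (P.monic _)]

theorem sum_natDegree [Fintype ι] : ∑ i, (P.poly i).natDegree = n := by
  simpa using Fintype.card_congr P.indexEquiv

theorem coeff_zero_ne_zero (h0 : ¬ Module.End.HasEigenvalue (toLin' A) 0) (i : ι) :
    (P.poly i).coeff 0 ≠ 0 := by
  have := P.finite
  cases nonempty_fintype ι
  rw [Module.End.hasEigenvalue_iff_isRoot_charpoly, charpoly_toLin', P.charpoly_eq_prod,
    IsRoot.def, eval_prod, Finset.prod_eq_zero_iff] at h0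
  exact fun hi => h0 ⟨i, Finset.mem_univ i, coeff_zero_eq_eval_zero (P.poly i) ▸ hi⟩

end CompanionBlocks

namespace LTISystem

section MinimalBlocks

variable {n nu : ℕ} {S : LTISystem n nu 1} {ι : Type*} [DecidableEq ι]

/-- Otherwise the product of the other blocks' polynomials would annihilate the response of the
whole system, which would therefore have a realization without the states of block `i`. -/
theorem IsMinimal.exists_block_response_ne_zero [Fintype ι] (hS : S.IsMinimal)
    (P : CompanionBlocks S.A ι) (i : ι) : ∃ q, ∏ l ∈ Finset.univ.erase i, P.poly l ∣ q ∧
      P.outputBlock S.C i * aeval (companionMatrix (P.poly i)) q * P.inputBlock S.B i ≠ 0 := by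
  by_contra! hzero
  have hle : n ≤ (∏ l ∈ Finset.univ.erase i, P.poly l).natDegree := by
    refine hS.le_natDegree (monic_prod_of_monic _ _ fun l _ => P.monic l) fun q hq => ?_
    rw [P.mul_aeval_mul]
    refine Finset.sum_eq_zero fun l _ => ?_
    by_cases hl : l = i
    · exact hl ▸ hzero q hq
    · have hdvd := (Finset.dvd_prod_of_mem P.poly
        (Finset.mem_erase.2 ⟨hl, Finset.mem_univ l⟩)).trans hq
      rw [aeval_companionMatrix_eq_zero_of_dvd (P.monic l) hdvd, Matrix.mul_zero, Matrix.zero_mul]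
  rw [natDegree_prod_of_monic _ _ fun l _ => P.monic l] at hle
  have hsum := Finset.add_sum_erase Finset.univ (fun l => (P.poly l).natDegree) (Finset.mem_univ i)
  have := P.sum_natDegree
  have := P.natDegree_pos i
  omega

theorem IsMinimal.inputBlock_ne_zero (hS : S.IsMinimal) (P : CompanionBlocks S.A ι) (i : ι) :
    P.inputBlock S.B i ≠ 0 := by
  have := P.finite
  cases nonempty_fintype ι
  obtain ⟨q, -, hq⟩ := hS.exists_block_response_ne_zero P i
  exact fun h => hq (by rw [h, Matrix.mul_zero])

theorem IsMinimal.outputBlock_ne_zero (hS : S.IsMinimal) (P : CompanionBlocks S.A ι) (i : ι) :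
    P.outputBlock S.C i ≠ 0 := by
  have := P.finite
  cases nonempty_fintype ι
  obtain ⟨q, -, hq⟩ := hS.exists_block_response_ne_zero P i
  exact fun h => hq (by rw [h, Matrix.zero_mul, Matrix.zero_mul])

theorem IsMinimal.not_poly_dvd_prod_erase [Fintype ι] (hS : S.IsMinimal)
    (P : CompanionBlocks S.A ι) (i : ι) : ¬ P.poly i ∣ ∏ l ∈ Finset.univ.erase i, P.poly l := by
  obtain ⟨q, hdvd, hq⟩ := hS.exists_block_response_ne_zero P i
  intro h
  apply hq
  rw [aeval_companionMatrix_eq_zero_of_dvd (P.monic i) (h.trans hdvd), Matrix.mul_zero,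
    Matrix.zero_mul]

theorem IsMinimal.numIrreducibleFactors_eq (hS : S.IsMinimal) (P : CompanionBlocks S.A ι)
    (hP : ∀ i, IsPrimePow (P.poly i)) : S.A.numIrreducibleFactors = Nat.card ι := by
  have := P.finite
  cases nonempty_fintype ι
  rw [Matrix.numIrreducibleFactors, P.charpoly_eq_prod]
  exact ncard_monic_irreducible_dvd_prod P.monic hP (hS.not_poly_dvd_prod_erase P)

end MinimalBlocks

end LTISystem

/-- `label` names the strong components of `G` by the elements of `ι`, in the case where no path
joins two different components and every component contains an edge. The latter is encoded by using
paths of positive length. -/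
structure IsComponentLabelling {V ι : Type*} (G : Digraph V) (label : V → ι) : Prop where
  surjective : Function.Surjective label
  transGen_iff : ∀ v w, TransGen G.Adj v w ↔ label v = label w

namespace IsComponentLabelling

variable {V ι : Type*} {G : Digraph V} {label : V → ι}

theorem label_eq_of_adj (h : IsComponentLabelling G label) {v w : V} (hvw : G.Adj v w) :
    label v = label w :=
  (h.transGen_iff v w).1 (.single hvw)

theorem reflTransGen_iff (h : IsComponentLabelling G label) (v w : V) :
    ReflTransGen G.Adj v w ↔ label v = label w := by
  rw [reflTransGen_iff_eq_or_transGen, h.transGen_iff]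
  exact or_iff_right_of_imp fun hwv => hwv ▸ rfl

theorem exists_adj (h : IsComponentLabelling G label) (c : ι) :
    ∃ v w, label v = c ∧ label w = c ∧ G.Adj v w := by
  obtain ⟨v, rfl⟩ := h.surjective c
  obtain ⟨w, hvw, -⟩ := TransGen.head'_iff.1 ((h.transGen_iff v v).2 rfl)
  exact ⟨v, w, rfl, (h.label_eq_of_adj hvw).symm, hvw⟩

end IsComponentLabelling

theorem isComponentLabelling_reindex_blockDiagonal' {ι V : Type*} [DecidableEq ι] {m : ι → Type*}
    [∀ i, Nonempty (m i)] {M : ∀ i, Matrix (m i) (m i) ℝ}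
    (hM : ∀ i a b, TransGen (M i).associatedGraph.Adj a b) (σ : (Σ i, m i) ≃ V) :
    IsComponentLabelling (reindex σ σ (blockDiagonal' M)).associatedGraph
      fun v => (σ.symm v).1 where
  surjective i := ⟨σ ⟨i, Classical.arbitrary (m i)⟩, by simp only [σ.symm_apply_apply]⟩
  transGen_iff v w := by
    constructor
    · intro h
      induction h with
      | single hvw => exact not_imp_comm.1 (blockDiagonal'_apply_ne M _ _) hvw |>.symm
      | tail _ hwz ih =>
        exact ih.trans (not_imp_comm.1 (blockDiagonal'_apply_ne M _ _) hwz).symm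
    · obtain ⟨⟨i, a⟩, rfl⟩ := σ.surjective v
      obtain ⟨⟨j, b⟩, rfl⟩ := σ.surjective w
      simp only [σ.symm_apply_apply]
      rintro rfl
      refine (hM i a b).lift (fun a => σ ⟨i, a⟩) fun c d hcd => ?_
      simpa [Function.onFun, Matrix.associatedGraph] using hcd

theorem CompanionBlocks.isComponentLabelling {n : ℕ} {A : Matrix (Fin n) (Fin n) ℝ} {ι : Type*}
    [DecidableEq ι] (P : CompanionBlocks A ι) (h0 : ∀ i, (P.poly i).coeff 0 ≠ 0) :
    IsComponentLabelling A.associatedGraph fun v => (P.indexEquiv.symm v).1 := by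
  have (i : ι) : Nonempty (Fin (P.poly i).natDegree) := ⟨⟨0, P.natDegree_pos i⟩⟩
  convert isComponentLabelling_reindex_blockDiagonal'
    (fun i => transGen_associatedGraph_companionMatrix (h0 i)) P.indexEquiv
  exact P.eq_reindex

namespace LTISystem

/-- The vertex of the `i`-th state variable in the graph of a system. -/
abbrev Vertex.state {nx nu ny : ℕ} (i : Fin nx) : Vertex nx nu ny :=
  .inl (.inl i)

section StateComponents

variable {n nu ny : ℕ} {S : LTISystem n nu ny} {ι : Type*} {label : Fin n → ι}

theorem not_graph_adj_of_output (y : Fin ny) (v : Vertex n nu ny) :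
    ¬ S.graph.Adj (.inr y) v := by
  rcases v with (i | u) | y' <;> exact fun h => h rfl

theorem exists_state_or_output_of_reflTransGen {i : Fin n} {v : Vertex n nu ny}
    (h : ReflTransGen S.graph.Adj (.state i) v) :
    (∃ j, v = .state j ∧ ReflTransGen S.A.associatedGraph.Adj i j) ∨ ∃ y, v = .inr y := by
  induction h with
  | refl => exact .inl ⟨i, rfl, .refl⟩
  | @tail v w _ hvw ih =>
    obtain ⟨j, rfl, hij⟩ | ⟨y, rfl⟩ := ih
    · rcases w with (k | u) | y
      · exact .inl ⟨k, rfl, hij.tail hvw⟩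
      · exact absurd rfl hvw
      · exact .inr ⟨y, rfl⟩
    · exact absurd hvw (not_graph_adj_of_output y w)

theorem reflTransGen_state_state {i j : Fin n} :
    ReflTransGen S.graph.Adj (.state i) (.state j) ↔ ReflTransGen S.A.associatedGraph.Adj i j := by
  refine ⟨fun h => ?_, fun h => h.lift Vertex.state fun _ _ hadj => hadj⟩
  obtain ⟨k, hk, hik⟩ | ⟨y, hy⟩ := exists_state_or_output_of_reflTransGen h
  · obtain rfl := Sum.inl_injective (Sum.inl_injective hk)
    exact hik
  · exact absurd hy Sum.inl_ne_inr

theorem strongComponent_state (h : IsComponentLabelling S.A.associatedGraph label) (i : Fin n) :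
    {v | ReflTransGen S.graph.Adj (.state i) v ∧ ReflTransGen S.graph.Adj v (.state i)} =
      Vertex.state '' (label ⁻¹' {label i}) := by
  ext v
  constructor
  · rintro ⟨hiv, hvi⟩
    obtain ⟨j, rfl, hij⟩ | ⟨y, rfl⟩ := exists_state_or_output_of_reflTransGen hiv
    · exact ⟨j, ((h.reflTransGen_iff i j).1 hij).symm, rfl⟩
    · obtain heq | ⟨w, hw, -⟩ := hvi.cases_head
      · exact absurd heq Sum.inr_ne_inl
      · exact absurd hw (not_graph_adj_of_output y w)
  · rintro ⟨j, hj, rfl⟩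
    exact ⟨reflTransGen_state_state.2 ((h.reflTransGen_iff i j).2 hj.symm),
      reflTransGen_state_state.2 ((h.reflTransGen_iff j i).2 hj)⟩

theorem stateComponents_eq_range (h : IsComponentLabelling S.A.associatedGraph label) :
    S.stateComponents = Set.range fun c => Vertex.state '' (label ⁻¹' {c}) := by
  ext s
  constructor
  · rintro ⟨⟨v, rfl⟩, hs⟩
    obtain ⟨i, rfl⟩ := hs v ⟨.refl, .refl⟩
    exact ⟨label i, (strongComponent_state h i).symm⟩
  · rintro ⟨c, rfl⟩
    obtain ⟨i, rfl⟩ := h.surjective c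
    refine ⟨⟨.state i, (strongComponent_state h i).symm⟩, ?_⟩
    rintro _ ⟨j, -, rfl⟩
    exact ⟨j, rfl⟩

/-- The bijection between the labels and the state components that they name. -/
noncomputable def componentEquiv (h : IsComponentLabelling S.A.associatedGraph label) :
    ι ≃ S.stateComponents :=
  (Equiv.ofInjective _ ((Set.image_injective.2
      (Sum.inl_injective.comp Sum.inl_injective)).comp
      (h.surjective.preimage_injective.comp Set.singleton_injective))).trans
    (Equiv.setCongr (stateComponents_eq_range h).symm)

end StateComponents

/-- The state components are in parallel: every input acts on and every output reads each of them,
and each has a loop but no edge to any other. -/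
structure IsParallel {n nu ny : ℕ} (S : LTISystem n nu ny) : Prop where
  input_adj : ∀ u c, S.condensedGraph.Adj (.input u) (.component c)
  adj_output : ∀ c y, S.condensedGraph.Adj (.component c) (.output y)
  adj_iff_eq : ∀ c c', S.condensedGraph.Adj (.component c) (.component c') ↔ c = c'

theorem isParallel_of_isComponentLabelling {n nu ny : ℕ} {S : LTISystem n nu ny} {ι : Type*}
    {label : Fin n → ι} (h : IsComponentLabelling S.A.associatedGraph label)
    (hB : ∀ c u, ∃ i, label i = c ∧ S.B i u ≠ 0) (hC : ∀ c y, ∃ i, label i = c ∧ S.C y i ≠ 0) :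
    S.IsParallel where
  input_adj u s := by
    obtain ⟨c, rfl⟩ := (componentEquiv h).surjective s
    obtain ⟨i, hi, hiu⟩ := hB c u
    exact ⟨.state i, ⟨i, hi, rfl⟩, hiu⟩
  adj_output s y := by
    obtain ⟨c, rfl⟩ := (componentEquiv h).surjective s
    obtain ⟨i, hi, hyi⟩ := hC c y
    exact ⟨.state i, ⟨i, hi, rfl⟩, hyi⟩
  adj_iff_eq s s' := by
    obtain ⟨c, rfl⟩ := (componentEquiv h).surjective s
    obtain ⟨c', rfl⟩ := (componentEquiv h).surjective s'
    rw [(componentEquiv h).injective.eq_iff]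
    constructor
    · rintro ⟨_, ⟨i, rfl, rfl⟩, _, ⟨j, rfl, rfl⟩, hij⟩
      exact h.label_eq_of_adj hij
    · rintro rfl
      obtain ⟨i, j, hi, hj, hij⟩ := h.exists_adj c
      exact ⟨.state i, ⟨i, hi, rfl⟩, .state j, ⟨j, hj, rfl⟩, hij⟩

section SameType

variable {n₁ nu₁ ny₁ n₂ nu₂ ny₂ : ℕ} {S₁ : LTISystem n₁ nu₁ ny₁} {S₂ : LTISystem n₂ nu₂ ny₂}

theorem sameType_input_iff {u : Fin nu₁} {v : S₂.CondensedVertex} :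
    SameType (.input u : S₁.CondensedVertex) v ↔ ∃ u', v = .input u' := by
  rcases v with _ | _ | _ <;> simp [SameType]

theorem sameType_output_iff {y : Fin ny₁} {v : S₂.CondensedVertex} :
    SameType (.output y : S₁.CondensedVertex) v ↔ ∃ y', v = .output y' := by
  rcases v with _ | _ | _ <;> simp [SameType]

theorem SameType.mem_range_component_iff {v : S₁.CondensedVertex} {w : S₂.CondensedVertex}
    (h : SameType v w) : v ∈ Set.range (CondensedVertex.component (S := S₁)) ↔
      w ∈ Set.range (CondensedVertex.component (S := S₂)) := by
  rcases v with _ | _ | _ <;> rcases w with _ | _ | _ <;> simp_all [SameType]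

theorem IsCGIsomorphism.card_stateComponents_eq {φ : S₁.CondensedVertex → S₂.CondensedVertex}
    (h : IsCGIsomorphism S₁ S₂ φ) : Nat.card S₁.stateComponents = Nat.card S₂.stateComponents :=
  Nat.card_congr <| (Equiv.ofInjective _ fun _ _ => CondensedVertex.component.inj).trans <|
    ((Equiv.ofBijective φ h.bijective).subtypeEquiv fun v =>
      (h.typeRestricted v).mem_range_component_iff).trans
    (Equiv.ofInjective _ fun _ _ => CondensedVertex.component.inj).symm

end SameType

section SISO

variable {n₁ n₂ : ℕ} {S₁ : LTISystem n₁ 1 1} {S₂ : LTISystem n₂ 1 1}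

theorem condensedGraph_adj_input_output {n : ℕ} (S : LTISystem n 1 1) (u y : Fin 1) :
    S.condensedGraph.Adj (.input u) (.output y) ↔ S.D ≠ 0 := by
  refine not_congr ⟨fun h => ?_, fun h => congrFun₂ h y u⟩
  ext i j
  rw [Subsingleton.elim i y, Subsingleton.elim j u]
  exact h

theorem IsCGIsomorphism.D_eq_zero_iff {φ : S₁.CondensedVertex → S₂.CondensedVertex}
    (h : IsCGIsomorphism S₁ S₂ φ) : S₁.D = 0 ↔ S₂.D = 0 := by
  obtain ⟨u, hu⟩ := sameType_input_iff.1 (h.typeRestricted (.input 0))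
  obtain ⟨y, hy⟩ := sameType_output_iff.1 (h.typeRestricted (.output 0))
  rw [← not_iff_not, ← Ne, ← Ne, ← condensedGraph_adj_input_output S₁ 0 0, h.adj_iff, hu, hy,
    condensedGraph_adj_input_output]

/-- The bijection of condensed vertices that matches up inputs and outputs by their index and state
components by `f`. -/
def CondensedVertex.mapComponents {n₁ n₂ nu ny : ℕ} {S₁ : LTISystem n₁ nu ny}
    {S₂ : LTISystem n₂ nu ny} (f : S₁.stateComponents ≃ S₂.stateComponents) :
    S₁.CondensedVertex ≃ S₂.CondensedVertex where
  toFun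
    | .input u => .input u
    | .component c => .component (f c)
    | .output y => .output y
  invFun
    | .input u => .input u
    | .component c => .component (f.symm c)
    | .output y => .output y
  left_inv := by rintro (u | c | y) <;> simp
  right_inv := by rintro (u | c | y) <;> simp

theorem IsParallel.isCGIsomorphism_mapComponents (h₁ : S₁.IsParallel) (h₂ : S₂.IsParallel)
    (f : S₁.stateComponents ≃ S₂.stateComponents) (hD : S₁.D = 0 ↔ S₂.D = 0) :
    IsCGIsomorphism S₁ S₂ (CondensedVertex.mapComponents f) where
  typeRestricted := by rintro (_ | _ | _) <;> exact trivial
  bijective := (CondensedVertex.mapComponents f).bijective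
  adj_iff := by
    rintro (u | c | y) (u' | c' | y')
    case input.component => exact iff_of_true (h₁.input_adj u c') (h₂.input_adj u (f c'))
    case component.output => exact iff_of_true (h₁.adj_output c y') (h₂.adj_output (f c) y')
    case component.component =>
      exact (h₁.adj_iff_eq c c').trans
        (f.injective.eq_iff.symm.trans (h₂.adj_iff_eq (f c) (f c')).symm)
    case input.output =>
      exact (condensedGraph_adj_input_output S₁ u y').trans
        ((not_congr hD).trans (condensedGraph_adj_input_output S₂ u y').symm)
    all_goals exact Iff.rfl

end SISO

section Minimal

variable {n n₁ n₂ : ℕ} {ι ι₁ ι₂ : Type*} [DecidableEq ι] [DecidableEq ι₁]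
  [DecidableEq ι₂]

theorem IsMinimal.isParallel {S : LTISystem n 1 1} (hS : S.IsMinimal) (P : CompanionBlocks S.A ι)
    (h0 : ∀ i, (P.poly i).coeff 0 ≠ 0) : S.IsParallel := by
  refine isParallel_of_isComponentLabelling (P.isComponentLabelling h0) (fun c u => ?_)
    fun c y => ?_
  · by_contra! hzero
    refine hS.inputBlock_ne_zero P c (Matrix.ext fun a u' => ?_)
    rw [Subsingleton.elim u' u]
    exact hzero _ (by rw [P.indexEquiv.symm_apply_apply])
  · by_contra! hzero
    refine hS.outputBlock_ne_zero P c (Matrix.ext fun y' a => ?_)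
    rw [Subsingleton.elim y' y]
    exact hzero _ (by rw [P.indexEquiv.symm_apply_apply])

theorem IsMinimal.cgIsomorphic_iff {S₁ : LTISystem n₁ 1 1} {S₂ : LTISystem n₂ 1 1}
    (hS₁ : S₁.IsMinimal) (hS₂ : S₂.IsMinimal)
    (P₁ : CompanionBlocks S₁.A ι₁) (P₂ : CompanionBlocks S₂.A ι₂)
    (h0₁ : ∀ i, (P₁.poly i).coeff 0 ≠ 0) (h0₂ : ∀ i, (P₂.poly i).coeff 0 ≠ 0) :
    S₁.CGIsomorphic S₂ ↔ Nat.card ι₁ = Nat.card ι₂ ∧ (S₁.D = 0 ↔ S₂.D = 0) := by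
  rw [Nat.card_congr (componentEquiv (P₁.isComponentLabelling h0₁)),
    Nat.card_congr (componentEquiv (P₂.isComponentLabelling h0₂))]
  constructor
  · rintro ⟨φ, hφ⟩
    exact ⟨hφ.card_stateComponents_eq, hφ.D_eq_zero_iff⟩
  · rintro ⟨hcard, hD⟩
    obtain ⟨f⟩ := Finite.card_eq.1 hcard
    exact ⟨_, (hS₁.isParallel P₁ h0₁).isCGIsomorphism_mapComponents (hS₂.isParallel P₂ h0₂) f hD⟩

end Minimal

end LTISystem

theorem mainTheorem7 {n₁ n₂ : ℕ} (S₁ : LTISystem n₁ 1 1) (S₂ : LTISystem n₂ 1 1)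
    (hmin₁ : S₁.IsMinimal) (hmin₂ : S₂.IsMinimal)
    (hnf₁ : S₁.A.IsSecondNaturalNormalForm) (hnf₂ : S₂.A.IsSecondNaturalNormalForm)
    (h0₁ : ¬ Module.End.HasEigenvalue (Matrix.toLin' S₁.A) 0)
    (h0₂ : ¬ Module.End.HasEigenvalue (Matrix.toLin' S₂.A) 0) :
    S₁.CGIsomorphic S₂ ↔
      (S₁.A.numIrreducibleFactors = S₂.A.numIrreducibleFactors ∧
        ((S₁.D = 0 ∧ S₂.D = 0) ∨ (S₁.D ≠ 0 ∧ S₂.D ≠ 0))) := by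
  obtain ⟨k₁, P₁, hP₁⟩ := exists_companionBlocks_of_isSecondNaturalNormalForm hnf₁
  obtain ⟨k₂, P₂, hP₂⟩ := exists_companionBlocks_of_isSecondNaturalNormalForm hnf₂
  rw [hmin₁.cgIsomorphic_iff hmin₂ P₁ P₂ (P₁.coeff_zero_ne_zero h0₁) (P₂.coeff_zero_ne_zero h0₂),
    hmin₁.numIrreducibleFactors_eq P₁ hP₁, hmin₂.numIrreducibleFactors_eq P₂ hP₂]
  tauto
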